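/- Let $n\ge 2$ and $k\ge 1$ be integers. Let $\mathbf{n}$ denote the $n$-element chain $0<1<\cdots<n-1$, and let $L=\mathbf{n}^k$ be the product of $k$ copies of $\mathbf{n}$, ordered componentwise, with bottom element $\mathbf{0}=(0,\dots,0)$. (Equivalently, $L$ is the poset of all submultisets of the multiset in which each of $1,\dots,k$ occurs exactly $n-1$ times.) For $Y\in L$, let $\operatorname{depth} Y$ be the maximal length $m$ of a chain $Y=Y_0>Y_1>\cdots>Y_m$ in $L$. For $X\le Y$ in $L$, let $[X,Y]=\{Z\in L: X\le Z\le Y\}$. An interval partition of $L\setminus\{\mathbf 0\}$ is a partition $P$ of this set into pairwise disjoint nonempty intervals $[X,Y]$. Put $$\operatorname{ndepth} P=\min_{[X,Y]\in P}\operatorname{depth} Y,\qquad \operatorname{ndepth}(\mathbf{n}^k\setminus\mathbf{0})=\max_P \operatorname{ndepth} P,$$ where the maximum is over all interval partitions $P$ of $L\setminus\{\mathbf 0\}$. Theorem. $$\operatorname{ndepth}(\mathbf{n}^k\setminus\mathbf{0})=(n-1)\left\lceil \frac{k}{2}\right\rceil.$$ -/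

import Mathlib

namespace NewDepth

/-- The depth of an element `x` of a poset `L`: the maximal length of a descending chain
`x = x₀ > x₁ > ⋯ > xₘ` in `L` (the length being the number `m` of steps). -/
noncomputable def depth {L : Type*} [PartialOrder L] (x : L) : ℕ∞ := Order.height x

/-- `P` is an interval partition of the subset `Q` of `L`: a family of nonempty intervals
`[X, Y]` of `L` (with `X ≤ Y`) which are pairwise disjoint and have union `Q`. -/
structure IsIntervalPartition {L : Type*} [PartialOrder L] (Q : Set L)
    (P : Set (NonemptyInterval L)) : Prop where
  pairwiseDisjoint : P.PairwiseDisjoint (fun I => Set.Icc I.fst I.snd)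
  iUnion_eq : ⋃ I ∈ P, Set.Icc I.fst I.snd = Q

/-- `d` is the new depth of the family of intervals `P`: the minimum of `depth Y`
over all `[X, Y] ∈ P`. -/
def IsPartitionNewDepth {L : Type*} [PartialOrder L] (P : Set (NonemptyInterval L))
    (d : ℕ∞) : Prop :=
  IsLeast ((fun I => depth I.snd) '' P) d

/-- `d` is the new depth of the subset `Q` of `L`: the maximum of the new depths of all interval
partitions of `Q`. Depths are measured in the whole poset `L`. -/
def IsNewDepth {L : Type*} [PartialOrder L] (Q : Set L) (d : ℕ∞) : Prop :=
  IsGreatest {e | ∃ P, IsIntervalPartition Q P ∧ IsPartitionNewDepth P e} d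

/-- The power `n^k` of the `n`-element chain `0 < 1 < ⋯ < n - 1`, ordered componentwise. -/
abbrev ChainPower (n k : ℕ) : Type := Fin k → Fin n

/-- `n^k ∖ 0`: the product of chains with its bottom element `(0, …, 0)` removed. -/
def chainPowerWithoutZero (n k : ℕ) : Set (ChainPower n k) :=
  {x | ∃ i, (x i : ℕ) ≠ 0}

end NewDepth

namespace NewDepth

/-! Depth is the coordinate sum (`depth_chainPower`), so supports of interval tops decide
everything. Upper bound: distinct atoms `e_i`, `e_j` lie in intervals whose tops cannot each reach
the other's coordinate, else both contain `e_i ⊔ e_j`, coincide, and have bottom `0`. Averaging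
gives a top with small support (`exists_sum_snd_le`). Lower bound: for odd `k`, index intervals by
independent sets `D` of a directed `k`-cycle. The support of a nonzero point determines its `D`, and
`D.card ≤ (k - 1) / 2` leaves enough coordinates maximal. Even `k` follows by adding a coordinate.
-/

lemma one_le_iff_ne_zero {m : ℕ} {a : Fin (m + 2)} : 1 ≤ a ↔ a ≠ 0 := by
  rw [← Fin.pos_iff_ne_zero, Fin.le_def, Fin.lt_def]
  simp [Nat.one_le_iff_ne_zero]

lemma depth_chainPower {n k : ℕ} (x : ChainPower n k) :
    depth x = ((∑ i, (x i : ℕ) : ℕ) : ℕ∞) := by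
  unfold depth
  apply le_antisymm
  · have hmono : StrictMono (fun y : ChainPower n k => ∑ i, (y i : ℕ)) := by
      intro y z hyz
      obtain ⟨hle, i, hi⟩ := Pi.lt_def.1 hyz
      exact Finset.sum_lt_sum (fun j _ => hle j) ⟨i, Finset.mem_univ i, hi⟩
    have h := Order.height_le_height_apply_of_strictMono _ hmono x
    rwa [Order.height_nat] at h
  · induction h : ∑ i, (x i : ℕ) generalizing x with
    | zero => simp
    | succ s ih =>
      obtain ⟨i, -, hi⟩ : ∃ i ∈ Finset.univ, (x i : ℕ) ≠ 0 :=
        Finset.exists_ne_zero_of_sum_ne_zero (by omega)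
      have hn : (x i : ℕ) - 1 < n := by omega
      let y : ChainPower n k := Function.update x i ⟨(x i : ℕ) - 1, hn⟩
      have hyx : y < x := by
        apply update_lt_self_iff.2
        rw [Fin.lt_def]
        exact Nat.sub_one_lt hi
      have hsum : ∑ j, (y j : ℕ) = s := by
        have h1 := Finset.add_sum_erase Finset.univ (fun j => (x j : ℕ)) (Finset.mem_univ i)
        have h2 := Finset.add_sum_erase Finset.univ (fun j => (y j : ℕ)) (Finset.mem_univ i)
        have h3 : ∑ j ∈ Finset.univ.erase i, (y j : ℕ) = ∑ j ∈ Finset.univ.erase i, (x j : ℕ) :=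
          Finset.sum_congr rfl fun j hj => by simp [y, Finset.ne_of_mem_erase hj]
        have h4 : (y i : ℕ) = x i - 1 := by simp [y]
        omega
      push_cast
      exact (add_le_add_left (ih y hsum) 1).trans (Order.height_add_one_le hyx)

lemma mem_chainPowerWithoutZero {m k : ℕ} {x : ChainPower (m + 2) k} :
    x ∈ chainPowerWithoutZero (m + 2) k ↔ x ≠ 0 := by
  simp only [chainPowerWithoutZero, Set.mem_ofPred_eq, ne_eq, funext_iff, not_forall, Pi.zero_apply,
    Fin.ext_iff, Fin.val_zero]

/-! ### The upper bound -/

/-- Each unordered pair carries at most one arrow and each vertex at most one loop, so the average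
out-degree is at most half of `Fintype.card ι + 1`. -/
lemma exists_two_mul_card_le {ι : Type*} [Fintype ι] [DecidableEq ι] [Nonempty ι]
    (r : ι → ι → Prop) [∀ i j, Decidable (r i j)] (h : ∀ i j, i ≠ j → r i j → ¬ r j i) :
    ∃ i, 2 * (Finset.univ.filter (r i)).card ≤ Fintype.card ι + 1 := by
  by_contra! hlt
  have hsum : ∑ i, (Fintype.card ι + 2) ≤ ∑ i, 2 * (Finset.univ.filter (r i)).card :=
    Finset.sum_le_sum fun i _ => hlt i
  have hpair : ∑ i, ∑ j, ((if r i j then 1 else 0) + (if r j i then 1 else 0)) ≤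
      ∑ i : ι, ∑ j, (1 + if i = j then 1 else 0) := by
    refine Finset.sum_le_sum fun i _ => Finset.sum_le_sum fun j _ => ?_
    have := h i j
    split_ifs <;> simp_all
  have hcount : ∑ i, ∑ j, ((if r i j then 1 else 0) + (if r j i then 1 else 0)) =
      ∑ i, 2 * (Finset.univ.filter (r i)).card := by
    simp only [Finset.sum_add_distrib]
    rw [Finset.sum_comm (f := fun i j => if r j i then 1 else 0), ← Finset.mul_sum, two_mul]
    simp only [Finset.card_filter]
  rw [hcount] at hpair
  have hpos : 0 < Fintype.card ι := Fintype.card_pos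
  simp [Finset.sum_add_distrib] at hpair hsum
  nlinarith

lemma exists_sum_snd_le {m k : ℕ} (hk : 1 ≤ k) {P : Set (NonemptyInterval (ChainPower (m + 2) k))}
    (hP : IsIntervalPartition (chainPowerWithoutZero (m + 2) k) P) :
    ∃ I ∈ P, ∑ i, (I.snd i : ℕ) ≤ (m + 1) * ((k + 1) / 2) := by
  have hatom : ∀ i : Fin k, ∃ I ∈ P, (Pi.single i 1 : ChainPower (m + 2) k) ∈
      Set.Icc I.fst I.snd := by
    intro i
    have : (Pi.single i 1 : ChainPower (m + 2) k) ∈ ⋃ I ∈ P, Set.Icc I.fst I.snd := by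
      rw [hP.iUnion_eq, mem_chainPowerWithoutZero]
      simp
    simpa only [Set.mem_iUnion, exists_prop] using this
  choose I hI hmem using hatom
  have : Nonempty (Fin k) := ⟨⟨0, hk⟩⟩
  obtain ⟨i, hi⟩ := exists_two_mul_card_le (fun i j => (I i).snd j ≠ 0) (by
    intro i j hij hr hr'
    let z : ChainPower (m + 2) k := Pi.single i 1 ⊔ Pi.single j 1
    have hle : ∀ a b, (I a).snd b ≠ 0 →
        (Pi.single b 1 : ChainPower (m + 2) k) ≤ (I a).snd := by
      intro a b hab c
      by_cases hc : c = b
      · subst hc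
        simpa using one_le_iff_ne_zero.2 hab
      · simp [hc]
    have hzi : z ∈ Set.Icc (I i).fst (I i).snd :=
      ⟨(hmem i).1.trans le_sup_left, sup_le (hmem i).2 (hle i j hr)⟩
    have hzj : z ∈ Set.Icc (I j).fst (I j).snd :=
      ⟨(hmem j).1.trans le_sup_right, sup_le (hle j i hr') (hmem j).2⟩
    have heq : I i = I j := hP.pairwiseDisjoint.elim_set (hI i) (hI j) z hzi hzj
    have hfst : (I i).fst ∈ chainPowerWithoutZero (m + 2) k := by
      rw [← hP.iUnion_eq]
      exact Set.mem_biUnion (hI i) ⟨le_rfl, (I i).fst_le_snd⟩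
    rw [mem_chainPowerWithoutZero] at hfst
    apply hfst
    funext c
    have h1 := (hmem i).1 c
    have h2 := (hmem j).1 c
    rw [← heq] at h2
    -- The common bottom lies below two distinct atoms, hence is `0`.
    by_cases hc : c = i
    · subst hc
      simpa [hij] using h2
    · simpa [hc] using h1)
  refine ⟨I i, hI i, ?_⟩
  rw [Fintype.card_fin] at hi
  have hsub : ∑ j, ((I i).snd j : ℕ) ≤
      ∑ j ∈ Finset.univ.filter (fun j => (I i).snd j ≠ 0), (m + 1) := by
    rw [Finset.sum_filter]
    refine Finset.sum_le_sum fun j _ => ?_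
    split_ifs with h
    · omega
    · simp [not_not.1 h]
  refine hsub.trans ?_
  rw [Finset.sum_const, smul_eq_mul, mul_comm]
  exact Nat.mul_le_mul_left _ (by omega)

/-! ### Interval partitions from independent sets of an odd cycle -/

open scoped Fin.CommRing in
/-- On a directed cycle every nonempty set `S` has exactly one `D` such that the successor of `i`
is in `D` iff `i` is neither in `S` nor in `D`. -/
lemma exists_cyclic_kernel {r : ℕ} (S : Fin (r + 1) → Prop) (hS : ∃ i, S i) :
    ∃ D : Finset (Fin (r + 1)), ∀ i, i + 1 ∈ D ↔ ¬ S i ∧ i ∉ D := by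
  classical
  obtain ⟨p, hp⟩ := hS
  -- Since `S p` forces `p + 1 ∉ D`, the recursion starts there with value false; the same fact
  -- makes it close up after one turn.
  obtain ⟨c, hc0, hcs⟩ : ∃ c : ℕ → Prop, ¬ c 0 ∧
      ∀ t, c (t + 1) ↔ ¬ S (p + 1 + (t : Fin (r + 1))) ∧ ¬ c t :=
    ⟨fun t => Nat.rec (motive := fun _ => Prop) False
      (fun t ct => ¬ S (p + 1 + (t : Fin (r + 1))) ∧ ¬ ct) t, id, fun _ => Iff.rfl⟩
  refine ⟨Finset.univ.filter fun i => c (i - (p + 1)).val, fun i => ?_⟩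
  simp only [Finset.mem_filter, Finset.mem_univ, true_and]
  have hshift : i + 1 - (p + 1) = i - (p + 1) + 1 := by abel
  rw [hshift, Fin.val_add_one]
  split_ifs with h
  · have hip : i = p := by
      have : i - (p + 1) + 1 = 0 := by rw [h, Fin.last_add_one]
      rwa [← hshift, add_sub_add_right_eq_sub, sub_eq_zero] at this
    subst hip
    simp [hc0, hp]
  · rw [hcs, Fin.cast_val_eq_self, add_sub_cancel]

open scoped Fin.CommRing in
lemma cyclic_kernel_unique {r : ℕ} {S : Fin (r + 1) → Prop} (hS : ∃ i, S i)
    {D E : Finset (Fin (r + 1))} (hD : ∀ i, i + 1 ∈ D ↔ ¬ S i ∧ i ∉ D)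
    (hE : ∀ i, i + 1 ∈ E ↔ ¬ S i ∧ i ∉ E) : D = E := by
  obtain ⟨p, hp⟩ := hS
  have key : ∀ t : ℕ, p + 1 + (t : Fin (r + 1)) ∈ D ↔ p + 1 + (t : Fin (r + 1)) ∈ E := by
    intro t
    induction t with
    | zero => simp [hD, hE, hp]
    | succ t ih => rw [Nat.cast_succ, ← add_assoc, hD, hE, ih]
  ext i
  have := key (i - (p + 1)).val
  rwa [Fin.cast_val_eq_self, add_sub_cancel] at this

lemma card_add_card_of_independent {r : ℕ} {D : Finset (Fin (r + 1))}
    (hD : ∀ i ∈ D, i + 1 ∉ D) :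
    (Finset.univ.filter fun i => i ∈ D ∨ i + 1 ∈ D).card = 2 * D.card ∧
      (Finset.univ.filter fun i => i + 1 ∈ D).card = D.card := by
  have hcard : (Finset.univ.filter fun i => i + 1 ∈ D).card = D.card :=
    Finset.card_bij' (fun i _ => i + 1) (fun i _ => i - 1) (by simp) (by simp) (by simp) (by simp)
  refine ⟨?_, hcard⟩
  rw [Finset.filter_or, Finset.card_union_of_disjoint, hcard, Finset.filter_univ_mem, two_mul]
  rw [Finset.disjoint_filter]
  exact fun i _ => hD i

/-- The interval attached to a set `D` of vertices of a cycle. -/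
def cycleInterval (m r : ℕ) (D : Finset (Fin (r + 1))) :
    NonemptyInterval (ChainPower (m + 2) (r + 1)) where
  fst i := if i ∈ D ∨ i + 1 ∈ D then 0 else 1
  snd i := if i + 1 ∈ D then 0 else Fin.last _
  fst_le_snd i := by
    by_cases h : i + 1 ∈ D
    · simp [h]
    · simp only [h, if_false]
      exact Fin.le_last _

/-- Turns membership into the kernel recursion with `S` the support of `x`, so existence and
uniqueness of kernels yield covering and disjointness. -/
lemma mem_cycleInterval {m r : ℕ} {D : Finset (Fin (r + 1))} (hD : ∀ i ∈ D, i + 1 ∉ D)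
    {x : ChainPower (m + 2) (r + 1)} :
    x ∈ Set.Icc (cycleInterval m r D).fst (cycleInterval m r D).snd ↔
      ∀ i, i + 1 ∈ D ↔ ¬ x i ≠ 0 ∧ i ∉ D := by
  rw [Set.mem_Icc, Pi.le_def, Pi.le_def, ← forall_and]
  refine forall_congr' fun i => ?_
  have hone : (1 : Fin (m + 2)) ≤ x i ↔ x i ≠ 0 := one_le_iff_ne_zero
  have hi := hD i
  by_cases h1 : i + 1 ∈ D <;> by_cases h2 : i ∈ D <;>
    simp_all [cycleInterval, Fin.le_last]

lemma exists_partition_odd (m s : ℕ) :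
    ∃ P, IsIntervalPartition (chainPowerWithoutZero (m + 2) (2 * s + 1)) P ∧
      ∀ I ∈ P, (m + 1) * (s + 1) ≤ ∑ i, (I.snd i : ℕ) := by
  have hne : ∀ {D : Finset (Fin (2 * s + 1))} {x : ChainPower (m + 2) (2 * s + 1)},
      (∀ i ∈ D, i + 1 ∉ D) →
      x ∈ Set.Icc (cycleInterval m _ D).fst (cycleInterval m _ D).snd → ∃ i, x i ≠ 0 := by
    intro D x hD hx
    by_contra! h0
    rw [mem_cycleInterval hD] at hx
    -- If `x = 0`, every `i` has `i ∈ D` or `i + 1 ∈ D`, so the odd cycle length would equal `2 *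
    -- D.card`.
    have hcard := (card_add_card_of_independent hD).1
    rw [Finset.filter_true_of_mem, Finset.card_univ, Fintype.card_fin] at hcard
    · omega
    · intro i _
      have := hx i
      simp only [h0 i] at this
      tauto
  refine ⟨cycleInterval m (2 * s) '' {D | ∀ i ∈ D, i + 1 ∉ D}, ⟨?_, ?_⟩, ?_⟩
  · rintro _ ⟨D, hD, rfl⟩ _ ⟨E, hE, rfl⟩ hDE
    refine Set.disjoint_left.2 fun x hxD hxE => hDE ?_
    have hx := hne hD hxD
    rw [mem_cycleInterval hD] at hxD
    rw [mem_cycleInterval hE] at hxE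
    rw [cyclic_kernel_unique (S := fun i => x i ≠ 0) hx hxD hxE]
  · ext x
    simp only [Set.mem_iUnion, exists_prop, Set.exists_mem_image]
    rw [mem_chainPowerWithoutZero, Function.ne_iff]
    constructor
    · rintro ⟨D, hD, hx⟩
      exact hne hD hx
    · intro hx
      obtain ⟨D, hD⟩ := exists_cyclic_kernel (fun i => x i ≠ 0) hx
      have hind : ∀ i ∈ D, i + 1 ∉ D := fun i hi hi' => ((hD i).1 hi').2 hi
      exact ⟨D, hind, (mem_cycleInterval hind).2 hD⟩
  · rintro _ ⟨D, hD, rfl⟩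
    obtain ⟨h1, h2⟩ := card_add_card_of_independent hD
    have h3 := Finset.card_le_univ (Finset.univ.filter fun i => i ∈ D ∨ i + 1 ∈ D)
    have h4 := Finset.card_filter_add_card_filter_not (s := Finset.univ) (fun i => i + 1 ∈ D)
    rw [Finset.card_univ] at h4
    rw [Fintype.card_fin] at h3 h4
    have hsum : ∑ i, ((cycleInterval m (2 * s) D).snd i : ℕ) =
        (Finset.univ.filter fun i => ¬ i + 1 ∈ D).card * (m + 1) := by
      rw [← smul_eq_mul _ (m + 1), ← Finset.sum_const, Finset.sum_filter]
      refine Finset.sum_congr rfl fun i _ => ?_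
      by_cases h : i + 1 ∈ D <;> simp [cycleInterval, h]
    refine le_of_le_of_eq ?_ hsum.symm
    rw [mul_comm]
    exact Nat.mul_le_mul_right _ (by omega)

/-- Prepending a coordinate: the old intervals at height `0`, and one interval above them. -/
lemma exists_partition_succ {m k d : ℕ} (hd : d ≤ (m + 1) * k)
    (h : ∃ P, IsIntervalPartition (chainPowerWithoutZero (m + 2) k) P ∧
      ∀ I ∈ P, d ≤ ∑ i, (I.snd i : ℕ)) :
    ∃ P, IsIntervalPartition (chainPowerWithoutZero (m + 2) (k + 1)) P ∧
      ∀ I ∈ P, d ≤ ∑ i, (I.snd i : ℕ) := by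
  obtain ⟨P, hP, hPd⟩ := h
  let lift : NonemptyInterval (ChainPower (m + 2) k) →
      NonemptyInterval (ChainPower (m + 2) (k + 1)) := fun I =>
    ⟨(Fin.cons 0 I.fst, Fin.cons 0 I.snd), Fin.cases le_rfl I.fst_le_snd⟩
  let upper : NonemptyInterval (ChainPower (m + 2) (k + 1)) :=
    ⟨(Fin.cons 1 0, fun _ => Fin.last _), fun i => Fin.le_last _⟩
  have hlift : ∀ I x, x ∈ Set.Icc (lift I).fst (lift I).snd ↔
      x 0 = 0 ∧ Fin.tail x ∈ Set.Icc I.fst I.snd := by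
    intro I x
    simp only [lift, Set.mem_Icc, Fin.cons_le, Fin.le_cons]
    have : x 0 ≤ 0 ↔ x 0 = 0 := Fin.le_zero_iff
    simp only [this, Fin.zero_le, true_and]
    tauto
  have hupper : ∀ x, x ∈ Set.Icc upper.fst upper.snd ↔ x 0 ≠ 0 := by
    intro x
    have h1 : x ≤ upper.snd := fun i => Fin.le_last _
    have h2 : (0 : ChainPower (m + 2) k) ≤ Fin.tail x := fun i => Fin.zero_le _
    rw [Set.mem_Icc, and_iff_left h1, ← one_le_iff_ne_zero]
    simp only [upper, Fin.cons_le, and_iff_left h2]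
  have htail : ∀ x : ChainPower (m + 2) (k + 1), x 0 = 0 →
      ((∃ I ∈ P, Fin.tail x ∈ Set.Icc I.fst I.snd) ↔ x ≠ 0) := by
    intro x hx
    have : (∃ I ∈ P, Fin.tail x ∈ Set.Icc I.fst I.snd) ↔
        Fin.tail x ∈ ⋃ I ∈ P, Set.Icc I.fst I.snd := by simp only [Set.mem_iUnion, exists_prop]
    rw [this, hP.iUnion_eq, mem_chainPowerWithoutZero, Function.ne_iff, Function.ne_iff,
      Fin.exists_fin_succ]
    simp [hx, Fin.tail]
  refine ⟨insert upper (lift '' P), ⟨?_, ?_⟩, ?_⟩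
  · rw [Set.pairwiseDisjoint_insert]
    refine ⟨?_, ?_⟩
    · rintro _ ⟨I, hI, rfl⟩ _ ⟨J, hJ, rfl⟩ hIJ
      refine Set.disjoint_left.2 fun x hxI hxJ => hIJ ?_
      rw [hlift] at hxI hxJ
      rw [hP.pairwiseDisjoint.elim_set hI hJ _ hxI.2 hxJ.2]
    · rintro _ ⟨I, hI, rfl⟩ -
      refine Set.disjoint_left.2 fun x hx hxI => ?_
      exact (hupper x).1 hx ((hlift I x).1 hxI).1
  · ext x
    simp only [Set.mem_iUnion, exists_prop, Set.exists_mem_insert, Set.exists_mem_image, hupper,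
      hlift, mem_chainPowerWithoutZero]
    by_cases hx : x 0 = 0
    · simp only [hx, ne_eq, not_true, false_or, true_and]
      exact htail x hx
    · have : x ≠ 0 := fun h => hx (by rw [h]; rfl)
      simp [hx, this]
  · rintro _ (rfl | ⟨I, hI, rfl⟩)
    · simp only [upper, Fin.val_last, Finset.sum_const, Finset.card_univ, Fintype.card_fin,
        smul_eq_mul]
      nlinarith
    · simpa [lift, Fin.sum_univ_succ] using hPd I hI

lemma exists_partition (m k : ℕ) (hk : 1 ≤ k) :
    ∃ P, IsIntervalPartition (chainPowerWithoutZero (m + 2) k) P ∧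
      ∀ I ∈ P, (m + 1) * ((k + 1) / 2) ≤ ∑ i, (I.snd i : ℕ) := by
  obtain ⟨s, rfl | rfl⟩ : ∃ s, k = 2 * s + 1 ∨ k = 2 * s + 1 + 1 := ⟨(k - 1) / 2, by omega⟩
  · rw [show (2 * s + 1 + 1) / 2 = s + 1 by omega]
    exact exists_partition_odd m s
  · rw [show (2 * s + 1 + 1 + 1) / 2 = s + 1 by omega]
    -- The target is the same for `2 * s + 1` and `2 * s + 2`, so the added coordinate need not gain
    -- depth.
    exact exists_partition_succ (Nat.mul_le_mul_left _ (by omega)) (exists_partition_odd m s)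

lemma natCeil_half (k : ℕ) : ⌈(k : ℚ) / 2⌉₊ = (k + 1) / 2 := by
  apply le_antisymm
  · rw [Nat.ceil_le, div_le_iff₀ two_pos]
    exact_mod_cast (show k ≤ (k + 1) / 2 * 2 by omega)
  · have h := Nat.le_ceil ((k : ℚ) / 2)
    rw [div_le_iff₀ two_pos] at h
    have : k ≤ ⌈(k : ℚ) / 2⌉₊ * 2 := by exact_mod_cast h
    omega

end NewDepth

theorem mainTheorem1 (n k : ℕ) (hn : 2 ≤ n) (hk : 1 ≤ k) :
    NewDepth.IsNewDepth (NewDepth.chainPowerWithoutZero n k)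
      (((n - 1) * ⌈(k : ℚ) / 2⌉₊ : ℕ) : ℕ∞) := by
  obtain ⟨m, rfl⟩ := Nat.exists_eq_add_of_le' hn
  rw [NewDepth.natCeil_half, show m + 2 - 1 = m + 1 from rfl]
  constructor
  · obtain ⟨P, hP, hlow⟩ := NewDepth.exists_partition m k hk
    -- The upper bound, applied to this same `P`, supplies an interval attaining the minimum.
    obtain ⟨I, hI, hup⟩ := NewDepth.exists_sum_snd_le hk hP
    refine ⟨P, hP, ⟨I, hI, ?_⟩, ?_⟩
    · simp only [NewDepth.depth_chainPower]
      exact congrArg _ (hup.antisymm (hlow I hI))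
    · rintro _ ⟨J, hJ, rfl⟩
      simp only [NewDepth.depth_chainPower]
      exact_mod_cast hlow J hJ
  · rintro e ⟨P, hP, he⟩
    obtain ⟨I, hI, hup⟩ := NewDepth.exists_sum_snd_le hk hP
    refine (he.2 ⟨I, hI, rfl⟩).trans ?_
    simp only [NewDepth.depth_chainPower]
    exact_mod_cast hup
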